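/- Let $\mathcal{X}$ be a finite set, let $E$ be a quantum system with finite-dimensional Hilbert space $\mathcal{H}_E$, and let $X$ be a random variable on $\mathcal{X}$ with quantum side information $E$, described by the classical-quantum state $\rho_{XE}=\sum_{x\in\mathcal{X}}|x\rangle\langle x|\otimes\rho_E^{[x]}$, where the $\rho_E^{[x]}$ are positive semidefinite operators on $\mathcal{H}_E$ and $\sum_x\operatorname{tr}\rho_E^{[x]}=1$. Let $$H_{\min}(X|E)=\max_{\sigma_E}\,\sup\{\lambda\in\mathbb{R}:\rho_{XE}\le 2^{-\lambda}\,\mathbb{1}_X\otimes\sigma_E\},$$ where $\sigma_E$ ranges over the density operators on $\mathcal{H}_E$. Let $\ell\ge 0$ be an integer, $\delta\ge 0$ a real number, and let $\mathcal{F}$ be a finite nonempty $\delta$-almost two-universal family of functions from $\mathcal{X}$ to $\{0,1\}^\ell$, i.e. $\Pr_f[f(x)=f(x')]\le\delta$ for all $x\ne x'$, with $f$ uniformly distributed on $\mathcal{F}$. For $f\in\mathcal{F}$ the state of $Z=f(X)$ and $E$ is $$\rho^{[f]}_{ZE}=\sum_{z\in\{0,1\}^\ell}|z\rangle\langle z|\otimes\sum_{x:f(x)=z}\rho_E^{[x]},$$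 and the distance from uniform of $Z$ conditioned on $E$ is $$d_u(Z|E)_{\rho^{[f]}}=\min_{\sigma_E}\tfrac12\big\|\rho^{[f]}_{ZE}-2^{-\ell}\,\mathbb{1}_Z\otimes\sigma_E\big\|_1,$$ where $\|A\|_1=\operatorname{tr}|A|$ and $\sigma_E$ ranges over the density operators on $\mathcal{H}_E$. Then $$\frac{1}{|\mathcal{F}|}\sum_{f\in\mathcal{F}}d_u(Z|E)_{\rho^{[f]}}\;\le\;\inf_{\varepsilon>0}\left(\frac12\sqrt{(2^\ell\delta-1)+2^{\ell-H_{\min}(X|E)+\log_2(2/\varepsilon^2+1)}}+\varepsilon\right).$$ Furthermore, if $\delta\le 2^{-\ell}$, i.e. if $\mathcal{F}$ is two-universal, then $$\frac{1}{|\mathcal{F}|}\sum_{f\in\mathcal{F}}d_u(Z|E)_{\rho^{[f]}}\;\le\;\frac12\sqrt{2^{\ell-H_{\min}(X|E)}}.$$ -/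

import Mathlib

namespace QHash

open scoped ComplexOrder MatrixOrder Kronecker

/-- The matrix `1_A / dim A`, i.e. the maximally mixed state `ω_A`. -/
noncomputable def maxMixed (a : Type*) [Fintype a] [DecidableEq a] : Matrix a a ℂ :=
  ((1 : ℝ) / (Fintype.card a : ℝ)) • (1 : Matrix a a ℂ)

/-- The marginal `ρ_B = tr_A ρ_AB` of an operator on `A ⊗ B`. -/
def marginal {a b : Type*} [Fintype a] (ρ : Matrix (a × b) (a × b) ℂ) : Matrix b b ℂ :=
  Matrix.of fun i j => ∑ k : a, ρ (k, i) (k, j)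

/-- Normalized quantum states: positive semidefinite operators of trace one. -/
def IsState {b : Type*} [Fintype b] (σ : Matrix b b ℂ) : Prop :=
  σ.PosSemidef ∧ σ.trace = 1

/-- The trace norm `‖A‖₁ = tr |A|`, where `|A| = √(A* A)`. -/
noncomputable def traceNorm {a : Type*} [Fintype a] [DecidableEq a] (A : Matrix a a ℂ) : ℝ :=
  (CFC.sqrt (A.conjTranspose * A)).trace.re

/-- The conditional min-entropy `H_min(A|B)_ρ = max_σ sup {t : ρ ≤ 2^(-t) 1_A ⊗ σ}` with `σ`
ranging over the normalized states on `B`. The two suprema are taken together, so that a `σ` for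
which no `t` is admissible (where the inner supremum is `-∞`) does not contribute. -/
noncomputable def minEntropy {a b : Type*} [Fintype a] [DecidableEq a] [Fintype b]
    [DecidableEq b] (ρ : Matrix (a × b) (a × b) ℂ) : ℝ :=
  sSup {t : ℝ | ∃ σ : Matrix b b ℂ, IsState σ ∧
    ρ ≤ ((2 : ℝ) ^ (-t)) • ((1 : Matrix a a ℂ) ⊗ₖ σ)}

/-- The distance from uniform of `A` conditioned on `B`: the minimum over positive semidefinite
`σ` on `B` with `tr σ = tr ρ_B` of the trace distance `½ ‖ρ - ω_A ⊗ σ‖₁`. -/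
noncomputable def distUniform {a b : Type*} [Fintype a] [DecidableEq a] [Fintype b]
    [DecidableEq b] (ρ : Matrix (a × b) (a × b) ℂ) : ℝ :=
  ⨅ σ : {σ : Matrix b b ℂ // σ.PosSemidef ∧ σ.trace = (marginal ρ).trace},
    (1 / 2 : ℝ) * traceNorm (ρ - maxMixed a ⊗ₖ (σ : Matrix b b ℂ))

/-- The classical-quantum operator `∑ x, |x⟩⟨x| ⊗ ρ^[x]`. -/
noncomputable def cqOp {X e : Type*} [Fintype X] [DecidableEq X] (ρ : X → Matrix e e ℂ) :
    Matrix (X × e) (X × e) ℂ :=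
  ∑ x : X, Matrix.single x x (1 : ℂ) ⊗ₖ ρ x

/-- The conditional operators `ρ^[x]` of a normalized classical-quantum state: each is positive
semidefinite, its trace is the probability of `x`, and the probabilities sum to one. -/
def IsCQ {X e : Type*} [Fintype X] [Fintype e] (ρ : X → Matrix e e ℂ) : Prop :=
  (∀ x, (ρ x).PosSemidef) ∧ ∑ x : X, (ρ x).trace = 1

/-- The conditional operators `ρ^[f,z] = ∑_{x : f x = z} ρ^[x]` after replacing `X` by `f X`. -/
def hashOp {X Z e : Type*} [Fintype X] [DecidableEq Z] (f : X → Z) (ρ : X → Matrix e e ℂ) :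
    Z → Matrix e e ℂ :=
  fun z => ∑ x : X with f x = z, ρ x

/-- A finite family of functions `f i : X → Z` is `δ`-almost two-universal: for uniformly random
`i`, the collision probability of any two distinct inputs is at most `δ`. -/
def AlmostTwoUniversal {ι X Z : Type*} [Fintype ι] [DecidableEq Z] (f : ι → X → Z) (δ : ℝ) :
    Prop :=
  ∀ x x' : X, x ≠ x' →
    ((Finset.univ.filter fun i : ι => f i x = f i x').card : ℝ) / (Fintype.card ι : ℝ) ≤ δ

/-- The distance from uniform of `Z = f X` conditioned on `E`, averaged over the uniformly random
choice of `f` from the family. -/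
noncomputable def avgDistUniform {ι X Z e : Type*} [Fintype ι] [Fintype X] [Fintype Z]
    [DecidableEq Z] [Fintype e] [DecidableEq e] (f : ι → X → Z) (ρ : X → Matrix e e ℂ) : ℝ :=
  ∑ i : ι, (1 / (Fintype.card ι : ℝ)) * distUniform (cqOp (hashOp (f i) ρ))

end QHash

/-!
The trace norm of a Hermitian `A` is `tr S A` with `S` the sign of `A`, so every estimate reduces to
the Cauchy–Schwarz inequality for the Hilbert–Schmidt inner product. Writing `A = B Y B` with `B`
positive, it gives `‖A‖₁ ≤ √(tr B²) √(tr B Y B Y)` (`re_trace_mul_sandwich_le`). Apply this to the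
difference between the hashed state and the ideal one, with the state written as `ρ x = B (Y x) B`.
The squared bound is quadratic in the `Y x`, and its average over the family involves only collision
probabilities: it is at most
`tr B² · (|Z| ∑ tr B Y_x B Y_x + (|Z| δ - 1) tr B Y_E B Y_E)`, where `Y_E = ∑ Y_x`
(`hashing_bound`).

If `ρ x ≤ 2^(-t) σ`, the choice `B = √σ` gives `Y_x ≤ 2^(-t)`, so the collision term is at most
`|Z| 2^(-t)`. When `|Z| δ ≤ 1` the other term can be dropped, and `t` tends to the min-entropy
(`avgDistUniform_le_of_twoUniversal`).

When `|Z| δ ≥ 1` one also needs `Y_E ≤ 1`. Let `τ = ∑ ρ x`, `ω = τ + η σ` and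
`G = √τ ω^(-1/2)`. The damped state `G ρ G*` has `B = √τ` and `Y_x = ω^(-1/2) ρ x ω^(-1/2)`, so that
`Y_E ≤ 1` and `Y_x ≤ 2^(-t) / η`. Operator monotonicity of the square root gives
`tr G ω ≥ tr τ`, hence `tr G τ ≥ 1 - η`, and a polarization argument (`re_trace_mul_sub_conj_le`)
turns this into a bound `ε` on the cost of replacing `ρ` by `G ρ G*`, with `1 / η = 2 / ε² + 1`
(`avgDistUniform_le_of_almostTwoUniversal`). The remaining case of the smoothed bound, `|Z| δ ≤ 1`,
follows from the two-universal one by elementary estimates.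
-/

namespace QHash

open scoped ComplexOrder MatrixOrder Kronecker

/-! ### Traces, contractions and the trace norm -/

section Matrix

variable {m n : Type*} [Fintype m] [Fintype n]

lemma re_trace_conjTranspose_mul_self_nonneg (A : Matrix m n ℂ) :
    0 ≤ (A.conjTranspose * A).trace.re :=
  (Complex.le_def.1 (Matrix.posSemidef_conjTranspose_mul_self A).trace_nonneg).1

lemma re_trace_conjTranspose (A : Matrix n n ℂ) : A.conjTranspose.trace.re = A.trace.re := by
  simp [Matrix.trace_conjTranspose]

/-- The Cauchy–Schwarz inequality for the Hilbert–Schmidt inner product. -/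
lemma re_trace_conjTranspose_mul_le (A B : Matrix m n ℂ) :
    (A.conjTranspose * B).trace.re ≤
      Real.sqrt (A.conjTranspose * A).trace.re * Real.sqrt (B.conjTranspose * B).trace.re := by
  have h : ∀ s : ℝ, 0 ≤ (A.conjTranspose * A).trace.re * (s * s)
      + (-2 * (A.conjTranspose * B).trace.re) * s + (B.conjTranspose * B).trace.re := by
    intro s
    have h1 := re_trace_conjTranspose_mul_self_nonneg ((s : ℂ) • A - B)
    have h2 : (B.conjTranspose * A).trace.re = (A.conjTranspose * B).trace.re := by
      rw [← re_trace_conjTranspose]; simp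
    simp only [Matrix.conjTranspose_sub, Matrix.conjTranspose_smul, Matrix.sub_mul, Matrix.mul_sub,
      Matrix.trace_sub, Matrix.smul_mul, Matrix.mul_smul, Matrix.trace_smul, Complex.sub_re] at h1
    simp [h2] at h1
    linarith
  have hd := discrim_le_zero h
  rw [discrim] at hd
  rw [← Real.sqrt_mul (re_trace_conjTranspose_mul_self_nonneg A)]
  refine Real.le_sqrt_of_sq_le ?_
  linarith

lemma exists_eq_mul_conjTranspose {P : Matrix n n ℂ} (hP : P.PosSemidef) :
    ∃ M : Matrix n n ℂ, P = M * M.conjTranspose := by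
  classical
  refine ⟨CFC.sqrt P, ?_⟩
  rw [(Matrix.nonneg_iff_posSemidef.1 (CFC.sqrt_nonneg P)).1.eq,
    CFC.sqrt_mul_sqrt_self P (Matrix.nonneg_iff_posSemidef.2 hP)]

lemma re_trace_nonneg {P : Matrix n n ℂ} (hP : 0 ≤ P) : 0 ≤ P.trace.re :=
  (Complex.le_def.1 (Matrix.nonneg_iff_posSemidef.1 hP).trace_nonneg).1

lemma re_trace_mono {P Q : Matrix n n ℂ} (h : P ≤ Q) : P.trace.re ≤ Q.trace.re := by
  have := re_trace_nonneg (sub_nonneg.2 h)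
  simp at this
  linarith

lemma conj_mono {P Q : Matrix n n ℂ} (h : P ≤ Q) (M : Matrix n m ℂ) :
    M.conjTranspose * P * M ≤ M.conjTranspose * Q * M := by
  rw [Matrix.le_iff, ← Matrix.sub_mul, ← Matrix.mul_sub]
  exact (Matrix.le_iff.1 h).conjTranspose_mul_mul_same M

lemma sandwich_nonneg {K P : Matrix n n ℂ} (hK : K.IsHermitian) (hP : 0 ≤ P) :
    0 ≤ K * P * K := by
  have h := conj_mono hP K
  rwa [hK.eq, Matrix.mul_zero, Matrix.zero_mul] at h

lemma re_trace_mul_mono {P Q R : Matrix n n ℂ} (hR : 0 ≤ R) (h : P ≤ Q) :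
    (R * P).trace.re ≤ (R * Q).trace.re := by
  obtain ⟨M, rfl⟩ := exists_eq_mul_conjTranspose (Matrix.nonneg_iff_posSemidef.1 hR)
  have := re_trace_mono (conj_mono h M)
  rwa [Matrix.trace_mul_comm, Matrix.trace_mul_comm _ M, ← Matrix.mul_assoc, ← Matrix.mul_assoc]
    at this

lemma re_trace_mul_nonneg {P R : Matrix n n ℂ} (hR : 0 ≤ R) (hP : 0 ≤ P) :
    0 ≤ (R * P).trace.re := by
  simpa using re_trace_mul_mono hR hP

variable [DecidableEq n]

lemma re_trace_contraction_mul_self_le {S : Matrix n n ℂ} (hS : S.conjTranspose * S ≤ 1)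
    (M : Matrix n m ℂ) :
    ((S * M).conjTranspose * (S * M)).trace.re ≤ (M.conjTranspose * M).trace.re := by
  have := re_trace_mono (conj_mono hS M)
  simpa [Matrix.mul_assoc] using this

lemma re_trace_contraction_mul_mul_conjTranspose_le {S : Matrix n n ℂ}
    (hS : S.conjTranspose * S ≤ 1) (M N : Matrix n m ℂ) :
    (S * (M * N.conjTranspose)).trace.re ≤ Real.sqrt (M.conjTranspose * M).trace.re *
      Real.sqrt (N.conjTranspose * N).trace.re := by
  have h1 := re_trace_conjTranspose_mul_le N (S * M)
  have h2 : (S * (M * N.conjTranspose)).trace = (N.conjTranspose * (S * M)).trace := by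
    rw [← Matrix.mul_assoc, Matrix.trace_mul_comm]
  rw [h2, mul_comm (Real.sqrt _)]
  exact h1.trans (mul_le_mul_of_nonneg_left
    (Real.sqrt_le_sqrt (re_trace_contraction_mul_self_le hS M)) (Real.sqrt_nonneg _))

lemma re_trace_contraction_mul_le {S : Matrix n n ℂ} (hS : S.conjTranspose * S ≤ 1)
    {P : Matrix n n ℂ} (hP : 0 ≤ P) : (S * P).trace.re ≤ P.trace.re := by
  obtain ⟨M, rfl⟩ := exists_eq_mul_conjTranspose (Matrix.nonneg_iff_posSemidef.1 hP)
  refine (re_trace_contraction_mul_mul_conjTranspose_le hS M M).trans ?_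
  rw [Real.mul_self_sqrt (re_trace_conjTranspose_mul_self_nonneg M), Matrix.trace_mul_comm]

/-- A Hermitian matrix `A` has a sign `S`: a Hermitian unitary with `S A = |A|`. -/
lemma exists_traceNorm_eq {A : Matrix n n ℂ} (hA : A.IsHermitian) :
    ∃ S : Matrix n n ℂ, S.IsHermitian ∧ S * S = 1 ∧ traceNorm A = (S * A).trace.re := by
  have hsa : IsSelfAdjoint A := hA
  have hc : ∀ g : ℝ → ℝ, ContinuousOn g (spectrum ℝ A) := fun g => by
    have : Finite (spectrum ℝ A) := Matrix.finite_real_spectrum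
    exact continuousOn_iff_continuous_domRestrict.2 continuous_of_discreteTopology
  let s : ℝ → ℝ := fun x => if x < 0 then -1 else 1
  refine ⟨cfc s A, (cfc_predicate s A : IsSelfAdjoint _), ?_, ?_⟩
  · rw [← cfc_mul s s A (hc _) (hc _), ← cfc_one ℝ A]
    refine cfc_congr fun x _ => ?_
    simp only [s]; split_ifs <;> simp
  · have h1 : cfc s A * A = cfc (fun x => s x * x) A := by
      conv_lhs => rw [← cfc_id ℝ A hsa, cfc_id ℝ A hsa]
      rw [cfc_mul s (fun x => x) A (hc _) (hc _), cfc_id' ℝ A hsa]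
    have h2 : CFC.sqrt (A.conjTranspose * A) = cfc (fun x : ℝ => ‖x‖) A :=
      CFC.abs_eq_cfc_norm A hsa
    rw [traceNorm, h1, h2]
    congr 2
    refine cfc_congr fun x _ => ?_
    simp only [s, Real.norm_eq_abs]
    split_ifs with h
    · rw [abs_of_neg h]; ring
    · rw [abs_of_nonneg (not_lt.1 h)]; ring

lemma traceNorm_nonneg (A : Matrix n n ℂ) : 0 ≤ traceNorm A :=
  re_trace_nonneg (CFC.sqrt_nonneg _)

open scoped Matrix.Norms.L2Operator in
/-- Operator monotonicity of the square root. -/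
lemma le_of_mul_self_le {P Q : Matrix n n ℂ} (hP : 0 ≤ P) (hQ : 0 ≤ Q) (h : P * P ≤ Q * Q) :
    P ≤ Q := by
  have := CFC.sqrt_le_sqrt (P * P) (Q * Q) h
  rwa [CFC.sqrt_mul_self P, CFC.sqrt_mul_self Q] at this

lemma le_re_trace_smul_one {P : Matrix n n ℂ} (hP : 0 ≤ P) :
    P ≤ P.trace.re • (1 : Matrix n n ℂ) := by
  have hP' := Matrix.nonneg_iff_posSemidef.1 hP
  have hh := hP'.1
  have hsa : IsSelfAdjoint P := hh
  rw [← Algebra.algebraMap_eq_smul_one, le_algebraMap_iff_spectrum_le]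
  intro x hx
  rw [hh.spectrum_real_eq_range_eigenvalues] at hx
  obtain ⟨i, rfl⟩ := hx
  rw [hh.trace_eq_sum_eigenvalues]
  simp only [Complex.re_sum, Complex.coe_algebraMap]
  simpa using Finset.single_le_sum (f := hh.eigenvalues)
    (fun j _ => hP'.eigenvalues_nonneg j) (Finset.mem_univ i)

end Matrix

/-! ### Block-diagonal algebra of classical-quantum operators -/

section CQ

variable {X e : Type*} [Fintype X] [DecidableEq X]

lemma cqOp_apply (ρ : X → Matrix e e ℂ) (p q : X × e) :
    cqOp ρ p q = if p.1 = q.1 then ρ p.1 p.2 q.2 else 0 := by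
  rw [cqOp, Matrix.sum_apply, Finset.sum_eq_single p.1]
  · by_cases h : p.1 = q.1 <;> simp [Matrix.kroneckerMap_apply, h]
  · intro x _ hx
    simp [Matrix.kroneckerMap_apply, hx]
  · simp

lemma cqOp_sub (ρ σ : X → Matrix e e ℂ) : cqOp (fun x => ρ x - σ x) = cqOp ρ - cqOp σ := by
  ext p q
  simp only [cqOp_apply, Matrix.sub_apply]
  split_ifs <;> simp

lemma cqOp_conjTranspose (ρ : X → Matrix e e ℂ) :
    (cqOp ρ).conjTranspose = cqOp fun x => (ρ x).conjTranspose := by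
  ext p q
  simp only [cqOp_apply, Matrix.conjTranspose_apply]
  by_cases h : p.1 = q.1
  · simp [h]
  · simp [h, Ne.symm h]

lemma one_kronecker_eq_cqOp (σ : Matrix e e ℂ) :
    (1 : Matrix X X ℂ) ⊗ₖ σ = cqOp fun _ => σ := by
  ext p q
  simp [cqOp_apply, Matrix.kroneckerMap_apply, Matrix.one_apply]

lemma smul_cqOp (c : ℝ) (ρ : X → Matrix e e ℂ) : c • cqOp ρ = cqOp fun x => c • ρ x := by
  ext p q
  simp [cqOp_apply]

lemma maxMixed_kronecker_eq_cqOp (σ : Matrix e e ℂ) :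
    maxMixed X ⊗ₖ σ = cqOp fun _ : X => (1 / (Fintype.card X : ℝ)) • σ := by
  rw [maxMixed, Matrix.smul_kronecker, one_kronecker_eq_cqOp, smul_cqOp]

lemma marginal_cqOp (ρ : X → Matrix e e ℂ) : marginal (cqOp ρ) = ∑ x, ρ x := by
  ext i j
  simp [marginal, cqOp_apply, Matrix.sum_apply]

lemma le_of_cqOp_le_cqOp {ρ σ : X → Matrix e e ℂ} (h : cqOp ρ ≤ cqOp σ) (x : X) : ρ x ≤ σ x := by
  have h1 := (Matrix.le_iff.1 h).submatrix fun i : e => (x, i)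
  rw [← cqOp_sub] at h1
  rw [Matrix.le_iff]
  convert h1 using 1
  ext i j
  simp [cqOp_apply]

variable [Fintype e]

lemma cqOp_mul (ρ σ : X → Matrix e e ℂ) : cqOp ρ * cqOp σ = cqOp fun x => ρ x * σ x := by
  ext p q
  simp only [Matrix.mul_apply, cqOp_apply, Fintype.sum_prod_type]
  rw [Finset.sum_eq_single p.1]
  · by_cases h : p.1 = q.1 <;> simp [h]
  · intro x _ hx
    simp [hx.symm]
  · simp

lemma trace_cqOp (ρ : X → Matrix e e ℂ) : (cqOp ρ).trace = ∑ x, (ρ x).trace := by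
  simp [Matrix.trace, cqOp_apply, Fintype.sum_prod_type]

lemma cqOp_nonneg {ρ : X → Matrix e e ℂ} (h : ∀ x, 0 ≤ ρ x) : 0 ≤ cqOp ρ := by
  choose M hM using fun x =>
    exists_eq_mul_conjTranspose (Matrix.nonneg_iff_posSemidef.1 (h x))
  have : cqOp ρ = cqOp M * (cqOp M).conjTranspose := by
    rw [cqOp_conjTranspose, cqOp_mul]
    exact congrArg _ (funext hM)
  rw [this]
  exact Matrix.nonneg_iff_posSemidef.2 (Matrix.posSemidef_self_mul_conjTranspose _)

end CQ

section HashOp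

variable {X Z e : Type*} [Fintype X] [DecidableEq Z]

lemma sum_hashOp [Fintype Z] (f : X → Z) (ρ : X → Matrix e e ℂ) :
    ∑ z, hashOp f ρ z = ∑ x, ρ x :=
  Finset.sum_fiberwise _ _ _

lemma hashOp_nonneg (f : X → Z) {ρ : X → Matrix e e ℂ} (h : ∀ x, 0 ≤ ρ x) (z : Z) :
    0 ≤ hashOp f ρ z :=
  Finset.sum_nonneg fun x _ => h x

lemma hashOp_conj [Fintype e] (f : X → Z) (ρ : X → Matrix e e ℂ) (K L : Matrix e e ℂ) (z : Z) :
    hashOp f (fun x => K * ρ x * L) z = K * hashOp f ρ z * L := by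
  simp [hashOp, Finset.mul_sum, Finset.sum_mul]

end HashOp

/-! ### Weighted Cauchy–Schwarz and averaging inequalities -/

section Core

variable {n : Type*} [Fintype n] [DecidableEq n]

/-- A weighted Cauchy–Schwarz inequality: with `Y = B⁻¹ A B⁻¹` and `S` the sign of `A` it reads
`‖A‖₁ ≤ √(tr B²) √(tr A B⁻¹ A B⁻¹)`, but no invertibility of `B` is needed in this form. -/
lemma re_trace_mul_sandwich_le {S B Y : Matrix n n ℂ} (hS : S.IsHermitian) (hS1 : S * S = 1)
    (hB : 0 ≤ B) (hY : Y.IsHermitian) :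
    (S * (B * Y * B)).trace.re ≤
      Real.sqrt (B * B).trace.re * Real.sqrt (B * Y * (B * Y)).trace.re := by
  have hBh : B.conjTranspose = B := (Matrix.nonneg_iff_posSemidef.1 hB).1.eq
  obtain ⟨C, hC, hCC⟩ : ∃ C : Matrix n n ℂ, C.conjTranspose = C ∧ B = C * C :=
    ⟨CFC.sqrt B, (Matrix.nonneg_iff_posSemidef.1 (CFC.sqrt_nonneg B)).1.eq,
      (CFC.sqrt_mul_sqrt_self B hB).symm⟩
  have h1 := re_trace_conjTranspose_mul_le (C * S * C) (C * Y * C)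
  have h2 := re_trace_conjTranspose_mul_le (B * S) (S * B)
  simp only [Matrix.conjTranspose_mul, hC, hBh, hS.eq, hY.eq] at h1 h2
  have e1 : (C * (S * C) * (C * Y * C)).trace = (S * (B * Y * B)).trace := by
    rw [hCC, Matrix.mul_assoc C, Matrix.trace_mul_comm C]
    simp only [Matrix.mul_assoc]
  have e2 : (C * (Y * C) * (C * Y * C)).trace = (B * Y * (B * Y)).trace := by
    rw [hCC, ← Matrix.mul_assoc, Matrix.trace_mul_comm _ C]
    simp only [Matrix.mul_assoc]
  have e3 : (C * (S * C) * (C * S * C)).trace = (S * B * (S * B)).trace := by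
    rw [hCC, Matrix.mul_assoc C, Matrix.trace_mul_comm C]
    simp only [Matrix.mul_assoc]
  have e4 : (S * B * (B * S)).trace = (B * B).trace := by
    rw [Matrix.mul_assoc, Matrix.trace_mul_comm S, Matrix.mul_assoc, Matrix.mul_assoc, hS1,
      Matrix.mul_one]
  have e5 : (B * S * (S * B)).trace = (B * B).trace := by
    rw [Matrix.mul_assoc, ← Matrix.mul_assoc S, hS1, Matrix.one_mul]
  have hBB : 0 ≤ (B * B).trace.re := re_trace_mul_nonneg hB hB
  rw [e4, e5, Real.mul_self_sqrt hBB] at h2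
  rw [e1, e2, e3] at h1
  exact h1.trans (mul_le_mul_of_nonneg_right (Real.sqrt_le_sqrt h2) (Real.sqrt_nonneg _))

/-- Concavity of the square root, for a uniform average. -/
lemma sum_mul_sqrt_le {ι : Type*} [Fintype ι] [Nonempty ι] (q : ι → ℝ) (hq : ∀ i, 0 ≤ q i) :
    ∑ i, 1 / (Fintype.card ι : ℝ) * Real.sqrt (q i) ≤
      Real.sqrt (∑ i, 1 / (Fintype.card ι : ℝ) * q i) := by
  have hc : (0 : ℝ) < Fintype.card ι := by exact_mod_cast Fintype.card_pos
  refine Real.le_sqrt_of_sq_le ?_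
  rw [← Finset.mul_sum, ← Finset.mul_sum, mul_pow]
  have h := sq_sum_le_card_mul_sum_sq (s := (Finset.univ : Finset ι))
    (f := fun i => Real.sqrt (q i))
  simp only [Real.sq_sqrt (hq _), Finset.card_univ] at h
  calc (1 / (Fintype.card ι : ℝ)) ^ 2 * (∑ i, Real.sqrt (q i)) ^ 2
      ≤ (1 / (Fintype.card ι : ℝ)) ^ 2 * (Fintype.card ι * ∑ i, q i) := by gcongr
    _ = _ := by field_simp

end Core

/-! ### Collisions under a random hash function -/

section Hash

variable {ι X Z e : Type*} [Fintype ι] [Fintype X] [DecidableEq Z] [Fintype e]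

/-- Subtracting the uniform average over `Z` turns the collision indicator into its deviation from
`1 / |Z|`. -/
lemma sum_trace_deviation [Fintype Z] [Nonempty Z] (f : X → Z) (B : Matrix e e ℂ)
    (Y : X → Matrix e e ℂ) :
    ∑ z, (B * (hashOp f Y z - (1 / (Fintype.card Z : ℝ)) • ∑ x, Y x) *
        (B * (hashOp f Y z - (1 / (Fintype.card Z : ℝ)) • ∑ x, Y x))).trace.re =
      ∑ x, ∑ x', ((if f x = f x' then 1 else 0) - 1 / (Fintype.card Z : ℝ)) *
        (B * Y x * (B * Y x')).trace.re := by
  have hc : (Fintype.card Z : ℝ) ≠ 0 := by exact_mod_cast Fintype.card_ne_zero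
  set N : ℝ := (Fintype.card Z : ℝ) with hN
  let a : X → Z → ℝ := fun x z => (if f x = z then 1 else 0) - 1 / N
  have hD : ∀ z, hashOp f Y z - (1 / N) • ∑ x, Y x = ∑ x, a x z • Y x := by
    intro z
    simp only [a, sub_smul, Finset.sum_sub_distrib, Finset.smul_sum, hashOp, Finset.sum_filter]
    congr 1
    refine Finset.sum_congr rfl fun x _ => ?_
    split_ifs <;> simp
  have ha : ∀ x x', ∑ z, a x z * a x' z = (if f x = f x' then 1 else 0) - 1 / N := by
    intro x x'
    have : ∀ z, a x z * a x' z = (if f x = z then (if f x' = z then 1 else 0) else 0)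
        - 1 / N * (if f x = z then 1 else 0) - 1 / N * (if f x' = z then 1 else 0)
        + 1 / N * (1 / N) := by
      intro z
      simp only [a]
      split_ifs <;> ring
    simp only [this, Finset.sum_add_distrib, Finset.sum_sub_distrib, ← Finset.mul_sum,
      Finset.sum_ite_eq, Finset.mem_univ, if_true, Finset.sum_const, Finset.card_univ,
      nsmul_eq_mul, ← hN]
    rw [if_congr (eq_comm (a := f x') (b := f x)) rfl rfl]
    field_simp
    ring
  have hg : ∀ z, (B * (∑ x, a x z • Y x) * (B * ∑ x, a x z • Y x)).trace.re =
      ∑ x, ∑ x', a x z * a x' z * (B * Y x * (B * Y x')).trace.re := by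
    intro z
    rw [Finset.mul_sum, Finset.sum_mul_sum, Matrix.trace_sum, Complex.re_sum]
    refine Finset.sum_congr rfl fun x _ => ?_
    rw [Matrix.trace_sum, Complex.re_sum]
    refine Finset.sum_congr rfl fun x' _ => ?_
    rw [Matrix.mul_smul, Matrix.mul_smul, Matrix.smul_mul, Matrix.mul_smul, smul_smul,
      Matrix.trace_smul, Complex.smul_re, smul_eq_mul]
  simp only [hD, hg, ← ha, Finset.sum_mul]
  rw [Finset.sum_comm]
  exact Finset.sum_congr rfl fun x _ => Finset.sum_comm

/-- Almost two-universality enters only here. The diagonal terms always collide; dropping their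
surplus `-δ g x x` is where `0 ≤ δ` is used. -/
lemma avg_collision_le [DecidableEq X] [Nonempty ι] {δ : ℝ} (hδ : 0 ≤ δ) {f : ι → X → Z}
    (hf : AlmostTwoUniversal f δ) (c : ℝ) (g : X → X → ℝ) (hg : ∀ x x', 0 ≤ g x x') :
    ∑ i, 1 / (Fintype.card ι : ℝ) * ∑ x, ∑ x', ((if f i x = f i x' then 1 else 0) - c) * g x x' ≤
      ∑ x, g x x + (δ - c) * ∑ x, ∑ x', g x x' := by
  have hc : (Fintype.card ι : ℝ) ≠ 0 := by exact_mod_cast Fintype.card_ne_zero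
  have h1 : ∑ i, 1 / (Fintype.card ι : ℝ) *
      ∑ x, ∑ x', ((if f i x = f i x' then 1 else 0) - c) * g x x' =
      ∑ x, ∑ x', (((Finset.univ.filter fun i : ι => f i x = f i x').card : ℝ) /
        (Fintype.card ι : ℝ) - c) * g x x' := by
    simp only [Finset.mul_sum]
    rw [Finset.sum_comm]
    refine Finset.sum_congr rfl fun x _ => ?_
    rw [Finset.sum_comm]
    refine Finset.sum_congr rfl fun x' _ => ?_
    simp only [← mul_assoc, ← Finset.sum_mul, ← Finset.mul_sum, Finset.sum_sub_distrib,
      Finset.sum_boole, Finset.sum_const, Finset.card_univ, nsmul_eq_mul]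
    field_simp
  have h2 : ∑ x, g x x + (δ - c) * ∑ x, ∑ x', g x x' =
      ∑ x, ∑ x', ((if x = x' then 1 else 0) + (δ - c)) * g x x' := by
    simp only [add_mul, Finset.sum_add_distrib, Finset.mul_sum, ite_mul, one_mul, zero_mul,
      Finset.sum_ite_eq, Finset.mem_univ, if_true]
  rw [h1, h2]
  refine Finset.sum_le_sum fun x _ => Finset.sum_le_sum fun x' _ => ?_
  refine mul_le_mul_of_nonneg_right ?_ (hg x x')
  split_ifs with h
  · subst h
    simp only [Finset.filter_true, Finset.card_univ, div_self hc]
    linarith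
  · linarith [hf x x' h]

end Hash

section Averaged

variable {ι X Z e : Type*} [Fintype ι] [Nonempty ι] [Fintype X] [Fintype Z] [Nonempty Z]
  [DecidableEq Z] [Fintype e] [DecidableEq e]

/-- Averaged over the family, the distance from uniform of `B Y B` is controlled by the collision
term `∑ tr B Y_x B Y_x`, bounded through `Y_x ≤ c`, and by the marginal term `tr B Y_E B Y_E`, where
`Y_E = ∑ Y_x`. The matrices `S i` play the role of the signs in the trace norms. -/
lemma hashing_bound {δ : ℝ} (hδ : 0 ≤ δ) {f : ι → X → Z} (hf : AlmostTwoUniversal f δ)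
    {B : Matrix e e ℂ} (hB : 0 ≤ B)
    {Y : X → Matrix e e ℂ} (hY : ∀ x, 0 ≤ Y x) {c : ℝ}
    (hYc : ∀ x, Y x ≤ c • (1 : Matrix e e ℂ))
    (S : ι → Matrix (Z × e) (Z × e) ℂ) (hS : ∀ i, (S i).IsHermitian) (hS1 : ∀ i, S i * S i = 1) :
    ∑ i, 1 / (Fintype.card ι : ℝ) * (S i * (cqOp (hashOp (f i) fun x => B * Y x * B) -
        maxMixed Z ⊗ₖ ∑ x, B * Y x * B)).trace.re ≤
      Real.sqrt ((B * B).trace.re *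
        (Fintype.card Z * (c * (∑ x, B * Y x * B).trace.re) +
          (Fintype.card Z * δ - 1) * (B * (∑ x, Y x) * (B * ∑ x, Y x)).trace.re)) := by
  classical
  have hBh : B.IsHermitian := (Matrix.nonneg_iff_posSemidef.1 hB).1
  have hYh : ∀ x, (Y x).conjTranspose = Y x := fun x => (Matrix.nonneg_iff_posSemidef.1 (hY x)).1.eq
  have hc : (0 : ℝ) < Fintype.card Z := by exact_mod_cast Fintype.card_pos
  set N : ℝ := (Fintype.card Z : ℝ) with hN
  let D : ι → Z → Matrix e e ℂ := fun i z => hashOp (f i) Y z - (1 / N) • ∑ x, Y x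
  let q : ι → ℝ := fun i => ∑ z, (B * D i z * (B * D i z)).trace.re
  have hD : ∀ i z, (D i z).IsHermitian := by
    intro i z
    have h1 : ((1 / N) • ∑ x, Y x).IsHermitian := by
      rw [Matrix.IsHermitian, Matrix.conjTranspose_smul, Matrix.conjTranspose_sum]
      simp [hYh]
    exact (Matrix.nonneg_iff_posSemidef.1 (hashOp_nonneg (f i) hY z)).1.sub h1
  have hq : ∀ i, 0 ≤ q i := fun i => Finset.sum_nonneg fun z _ => by
    rw [Matrix.mul_assoc, ← Matrix.mul_assoc (D i z)]
    exact re_trace_mul_nonneg hB (sandwich_nonneg (hD i z) hB)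
  have hBB : 0 ≤ (B * B).trace.re := re_trace_mul_nonneg hB hB
  have hg : ∀ x x', 0 ≤ (B * Y x * (B * Y x')).trace.re := by
    intro x x'
    rw [← Matrix.mul_assoc]
    exact re_trace_mul_nonneg (sandwich_nonneg hBh (hY x)) (hY x')
  -- each term is bounded by the weighted Cauchy–Schwarz inequality with weight `1 ⊗ B`
  have h1 : ∀ i, (S i * (cqOp (hashOp (f i) fun x => B * Y x * B) -
        maxMixed Z ⊗ₖ ∑ x, B * Y x * B)).trace.re ≤ Real.sqrt (N * (B * B).trace.re * q i) := by
    intro i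
    have hA : cqOp (hashOp (f i) fun x => B * Y x * B) - maxMixed Z ⊗ₖ ∑ x, B * Y x * B =
        cqOp (fun _ : Z => B) * cqOp (D i) * cqOp (fun _ => B) := by
      rw [maxMixed_kronecker_eq_cqOp, ← cqOp_sub, cqOp_mul, cqOp_mul]
      congr 1
      funext z
      simp only [D, hashOp_conj, Matrix.mul_sub, Matrix.sub_mul, Finset.mul_sum, Finset.sum_mul,
        Matrix.mul_smul, Matrix.smul_mul, hN]
    have hDh : (cqOp (D i)).IsHermitian := by
      rw [Matrix.IsHermitian, cqOp_conjTranspose]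
      simp only [(hD i _).eq]
    have := re_trace_mul_sandwich_le (hS i) (hS1 i) (cqOp_nonneg fun _ : Z => hB) hDh
    rw [hA]
    refine this.trans (le_of_eq ?_)
    rw [← Real.sqrt_mul (re_trace_mul_nonneg (cqOp_nonneg fun _ => hB) (cqOp_nonneg fun _ => hB))]
    simp only [cqOp_mul, trace_cqOp, Complex.re_sum, Finset.sum_const, Finset.card_univ,
      nsmul_eq_mul, q, hN, ← Complex.ofReal_natCast, Complex.re_ofReal_mul]
  have h2 : ∑ i, 1 / (Fintype.card ι : ℝ) * q i ≤
      c * (∑ x, B * Y x * B).trace.re +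
        (δ - 1 / N) * (B * (∑ x, Y x) * (B * ∑ x, Y x)).trace.re := by
    simp only [q, D, hN, sum_trace_deviation]
    refine (avg_collision_le hδ hf _ _ hg).trans ?_
    refine add_le_add ?_ (le_of_eq ?_)
    · rw [Matrix.trace_sum, Complex.re_sum, Finset.mul_sum]
      refine Finset.sum_le_sum fun x _ => ?_
      have := re_trace_mul_mono (sandwich_nonneg hBh (hY x)) (hYc x)
      rw [Matrix.mul_smul, Matrix.mul_one, Matrix.trace_smul, Complex.smul_re, smul_eq_mul] at this
      rwa [← Matrix.mul_assoc]
    · congr 1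
      rw [Finset.mul_sum, Finset.sum_mul_sum, Matrix.trace_sum, Complex.re_sum]
      refine Finset.sum_congr rfl fun x _ => ?_
      rw [Matrix.trace_sum, Complex.re_sum]
  calc _ ≤ ∑ i, 1 / (Fintype.card ι : ℝ) * Real.sqrt (N * (B * B).trace.re * q i) :=
        Finset.sum_le_sum fun i _ => mul_le_mul_of_nonneg_left (h1 i) (by positivity)
    _ ≤ Real.sqrt (∑ i, 1 / (Fintype.card ι : ℝ) * (N * (B * B).trace.re * q i)) :=
        sum_mul_sqrt_le _ fun i => mul_nonneg (mul_nonneg hc.le hBB) (hq i)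
    _ ≤ _ := by
        refine Real.sqrt_le_sqrt ?_
        have : ∑ i, 1 / (Fintype.card ι : ℝ) * (N * (B * B).trace.re * q i) =
            N * (B * B).trace.re * ∑ i, 1 / (Fintype.card ι : ℝ) * q i := by
          rw [Finset.mul_sum]
          exact Finset.sum_congr rfl fun i _ => by ring
        rw [this]
        refine (mul_le_mul_of_nonneg_left h2 (mul_nonneg hc.le hBB)).trans (le_of_eq ?_)
        field_simp

end Averaged

/-! ### Disturbance of a state by a contraction -/

section Disturbance

variable {n : Type*} [Fintype n]

lemma re_trace_sub_conjTranspose_mul_self (G M : Matrix n n ℂ) :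
    ((M - G * M).conjTranspose * (M - G * M)).trace.re =
      (M * M.conjTranspose).trace.re + (G * (M * M.conjTranspose) * G.conjTranspose).trace.re -
        2 * (G * (M * M.conjTranspose)).trace.re := by
  have hcross : (M.conjTranspose * (G.conjTranspose * M)).trace.re =
      (M.conjTranspose * (G * M)).trace.re := by
    rw [← re_trace_conjTranspose]
    simp [Matrix.mul_assoc]
  have hG : (G * (M * M.conjTranspose)).trace = (M.conjTranspose * (G * M)).trace := by
    rw [← Matrix.mul_assoc, Matrix.trace_mul_comm]
  have hGG : (G * (M * M.conjTranspose) * G.conjTranspose).trace =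
      (M.conjTranspose * (G.conjTranspose * (G * M))).trace := by
    rw [← Matrix.mul_assoc, Matrix.mul_assoc (G * M), Matrix.trace_mul_comm]
    simp only [Matrix.mul_assoc]
  rw [Matrix.trace_mul_comm M, hG, hGG]
  simp only [Matrix.conjTranspose_sub, Matrix.conjTranspose_mul, Matrix.sub_mul, Matrix.mul_sub,
    Matrix.trace_sub, Complex.sub_re, Matrix.mul_assoc, hcross]
  ring

lemma re_trace_add_conjTranspose_mul_self (G M : Matrix n n ℂ) :
    ((M + G * M).conjTranspose * (M + G * M)).trace.re =
      (M * M.conjTranspose).trace.re + (G * (M * M.conjTranspose) * G.conjTranspose).trace.re +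
        2 * (G * (M * M.conjTranspose)).trace.re := by
  have h := re_trace_sub_conjTranspose_mul_self (-G) M
  simpa using h

variable [DecidableEq n]

/-- The trace-norm disturbance caused by `P ↦ G P G*`. It is bounded by polarizing the difference
`M M* - (G M) (G M)*`, where `P = M M*`, which makes purifications and fidelities unnecessary. -/
lemma re_trace_mul_sub_conj_le {S : Matrix n n ℂ} (hS : S.conjTranspose * S ≤ 1)
    {P : Matrix n n ℂ} (hP : 0 ≤ P) (G : Matrix n n ℂ) :
    (S * (P - G * P * G.conjTranspose)).trace.re ≤
      Real.sqrt (P.trace.re + (G * P * G.conjTranspose).trace.re - 2 * (G * P).trace.re) *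
      Real.sqrt (P.trace.re + (G * P * G.conjTranspose).trace.re + 2 * (G * P).trace.re) := by
  obtain ⟨M, rfl⟩ := exists_eq_mul_conjTranspose (Matrix.nonneg_iff_posSemidef.1 hP)
  have hpol : (2 : ℂ) • (S * (M * M.conjTranspose - G * (M * M.conjTranspose) * G.conjTranspose)) =
      S * ((M - G * M) * (M + G * M).conjTranspose) +
        S * ((M + G * M) * (M - G * M).conjTranspose) := by
    simp only [two_smul, Matrix.conjTranspose_add, Matrix.conjTranspose_sub,
      Matrix.conjTranspose_mul]
    noncomm_ring
  have h1 := re_trace_contraction_mul_mul_conjTranspose_le hS (M - G * M) (M + G * M)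
  have h2 := re_trace_contraction_mul_mul_conjTranspose_le hS (M + G * M) (M - G * M)
  have h3 := congrArg (fun A => (Matrix.trace A).re) hpol
  simp only [Matrix.trace_smul, Matrix.trace_add, Complex.add_re, smul_eq_mul, Complex.mul_re,
    Complex.re_ofNat, Complex.im_ofNat, zero_mul, sub_zero] at h3
  rw [re_trace_sub_conjTranspose_mul_self, re_trace_add_conjTranspose_mul_self] at h1 h2
  linarith

/-- The disturbance bound for an overlap `F` and a remaining weight `n`, plus the cost of topping
the weight up to one. The sum is at most `√(1 - F²)`, which is at most `ε` when
`1 - F ≤ ε² / (2 + ε²)`. -/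
lemma half_sqrt_mul_sqrt_add_le {ε F n : ℝ} (hε : 0 < ε) (hF : 1 - ε ^ 2 / (2 + ε ^ 2) ≤ F)
    (hn0 : 0 ≤ n) (hn : n ≤ 1) (hFn : 0 ≤ 1 + n - 2 * F) :
    1 / 2 * (Real.sqrt (1 + n - 2 * F) * Real.sqrt (1 + n + 2 * F)) + 1 / 2 * (1 - n) ≤ ε := by
  obtain ⟨η, hη⟩ : ∃ η, η = ε ^ 2 / (2 + ε ^ 2) := ⟨_, rfl⟩
  rw [← hη] at hF
  have hη' : η * (2 + ε ^ 2) = ε ^ 2 := by rw [hη]; field_simp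
  have h0 : 0 ≤ η := by rw [hη]; positivity
  have h1 : η ≤ 1 := by nlinarith
  have h2 : 2 * η ≤ ε ^ 2 := by nlinarith [mul_nonneg h0 (sq_nonneg ε)]
  have h3 : η ≤ ε := by
    rw [hη, div_le_iff₀ (by positivity)]
    nlinarith [mul_nonneg hε.le (sq_nonneg (ε - 1)), mul_pos hε hε]
  rw [← Real.sqrt_mul hFn]
  have h4 : Real.sqrt ((1 + n - 2 * F) * (1 + n + 2 * F)) ≤ 2 * ε - (1 - n) := by
    refine Real.sqrt_le_iff.2 ⟨by linarith, ?_⟩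
    have hF2 : (1 - η) ^ 2 ≤ F ^ 2 := by
      have : 0 ≤ 1 - η := by linarith
      gcongr
    rcases le_total ε 1 with h | h
    · nlinarith [mul_nonneg (sub_nonneg.2 hn) (sub_nonneg.2 h), sq_nonneg η]
    · nlinarith [mul_nonneg hn0 (sub_nonneg.2 h), sq_nonneg (1 - η),
        mul_nonneg hε.le (sub_nonneg.2 h)]
  linarith

end Disturbance

/-! ### Distance from uniform of a hashed state -/

section States

variable {X Z e : Type*} [Fintype X] [Fintype Z] [DecidableEq Z] [Fintype e]

lemma maxMixed_kronecker_nonneg {σ : Matrix e e ℂ} (hσ : 0 ≤ σ) : 0 ≤ maxMixed Z ⊗ₖ σ := by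
  rw [maxMixed_kronecker_eq_cqOp]
  refine cqOp_nonneg fun _ => ?_
  exact Matrix.nonneg_iff_posSemidef.2
    ((Matrix.nonneg_iff_posSemidef.1 hσ).smul (by positivity))

lemma trace_maxMixed_kronecker [Nonempty Z] (σ : Matrix e e ℂ) :
    (maxMixed Z ⊗ₖ σ).trace = σ.trace := by
  have hc : (Fintype.card Z : ℂ) ≠ 0 := by exact_mod_cast Fintype.card_ne_zero
  simp [maxMixed_kronecker_eq_cqOp, trace_cqOp, hc]

variable [DecidableEq e]

/-- Dual form of an upper bound on the distance from uniform: any admissible `σ` gives the bound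
`½ tr S (ρ - ω ⊗ σ)` for some Hermitian unitary `S`. -/
lemma exists_distUniform_le (f : X → Z) {ρ : X → Matrix e e ℂ} (hρ : IsCQ ρ) {σ : Matrix e e ℂ}
    (hσ : 0 ≤ σ) (hσ1 : σ.trace = 1) :
    ∃ S : Matrix (Z × e) (Z × e) ℂ, S.IsHermitian ∧ S * S = 1 ∧
      distUniform (cqOp (hashOp f ρ)) ≤
        1 / 2 * (S * (cqOp (hashOp f ρ) - maxMixed Z ⊗ₖ σ)).trace.re := by
  have hP : 0 ≤ cqOp (hashOp f ρ) :=
    cqOp_nonneg (hashOp_nonneg f fun x => Matrix.nonneg_iff_posSemidef.2 (hρ.1 x))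
  have hA : (cqOp (hashOp f ρ) - maxMixed Z ⊗ₖ σ).IsHermitian :=
    (Matrix.nonneg_iff_posSemidef.1 hP).1.sub
      (Matrix.nonneg_iff_posSemidef.1 (maxMixed_kronecker_nonneg hσ)).1
  obtain ⟨S, hS, hS1, hSA⟩ := exists_traceNorm_eq hA
  refine ⟨S, hS, hS1, ?_⟩
  rw [← hSA]
  have htr : σ.trace = (marginal (cqOp (hashOp f ρ))).trace := by
    rw [hσ1, marginal_cqOp, sum_hashOp, Matrix.trace_sum, hρ.2]
  refine ciInf_le (f := fun σ : {σ : Matrix e e ℂ // σ.PosSemidef ∧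
      σ.trace = (marginal (cqOp (hashOp f ρ))).trace} =>
      (1 / 2 : ℝ) * traceNorm (cqOp (hashOp f ρ) - maxMixed Z ⊗ₖ (σ : Matrix e e ℂ))) ?_
    ⟨σ, Matrix.nonneg_iff_posSemidef.1 hσ, htr⟩
  refine ⟨0, ?_⟩
  rintro _ ⟨σ', rfl⟩
  exact mul_nonneg (by norm_num) (traceNorm_nonneg _)

/-- A positive definite `ω` has an invertible positive square root `R`, with inverse `W`. -/
lemma exists_sqrt_inv {ω : Matrix e e ℂ} (hω : ω.PosDef) :
    ∃ R W : Matrix e e ℂ, 0 ≤ R ∧ R * R = ω ∧ W.IsHermitian ∧ W * R = 1 ∧ R * W = 1 := by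
  have h0 : 0 ≤ ω := Matrix.nonneg_iff_posSemidef.2 hω.posSemidef
  have hR : 0 ≤ CFC.sqrt ω := CFC.sqrt_nonneg ω
  have hRR : CFC.sqrt ω * CFC.sqrt ω = ω := CFC.sqrt_mul_sqrt_self ω h0
  have hu : IsUnit (CFC.sqrt ω).det := by
    have h1 := (Matrix.isUnit_iff_isUnit_det ω).1 hω.isUnit
    rw [← hRR, Matrix.det_mul] at h1
    exact isUnit_of_mul_isUnit_left h1
  exact ⟨CFC.sqrt ω, (CFC.sqrt ω)⁻¹, hR, hRR, (Matrix.nonneg_iff_posSemidef.1 hR).1.inv,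
    Matrix.nonsing_inv_mul _ hu, Matrix.mul_nonsing_inv _ hu⟩

end States

section Bounds

variable {ι X Z e : Type*} [Fintype ι] [Nonempty ι] [Fintype X] [Fintype Z] [Nonempty Z]
  [DecidableEq Z] [Fintype e] [DecidableEq e]

/-- The bound for families with `|Z| δ ≤ 1`: take the weight `B = √σ`, so that `B Y_x B = ρ x` for
`Y_x = σ^(-1/2) ρ x σ^(-1/2) ≤ c`; the marginal term has a nonpositive coefficient. -/
theorem avgDistUniform_le_of_twoUniversal {δ : ℝ} (hδ : 0 ≤ δ) {f : ι → X → Z}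
    (hf : AlmostTwoUniversal f δ) (hδZ : Fintype.card Z * δ ≤ 1) {ρ : X → Matrix e e ℂ}
    (hρ : IsCQ ρ) {σ : Matrix e e ℂ} (hσ : σ.PosDef) (hσ1 : σ.trace = 1) {c : ℝ}
    (hc : ∀ x, ρ x ≤ c • σ) :
    avgDistUniform f ρ ≤ 1 / 2 * Real.sqrt (Fintype.card Z * c) := by
  have hρ0 : ∀ x, 0 ≤ ρ x := fun x => Matrix.nonneg_iff_posSemidef.2 (hρ.1 x)
  obtain ⟨R, W, hR, hRR, hW, hWR, hRW⟩ := exists_sqrt_inv hσ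
  have hRh : R.IsHermitian := (Matrix.nonneg_iff_posSemidef.1 hR).1
  have hY : ∀ x, 0 ≤ W * ρ x * W := fun x => sandwich_nonneg hW (hρ0 x)
  have hYc : ∀ x, W * ρ x * W ≤ c • (1 : Matrix e e ℂ) := fun x => by
    have h := conj_mono (hc x) W
    rw [hW.eq, Matrix.mul_smul, Matrix.smul_mul] at h
    rwa [← hRR, ← Matrix.mul_assoc, hWR, Matrix.one_mul, hRW] at h
  have hA : ∀ x, R * (W * ρ x * W) * R = ρ x := fun x => by
    rw [Matrix.mul_assoc, Matrix.mul_assoc _ W, hWR, Matrix.mul_one, ← Matrix.mul_assoc, hRW,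
      Matrix.one_mul]
  have htr : (∑ x, ρ x).trace = 1 := by rw [Matrix.trace_sum, hρ.2]
  choose S hS hS1 hSd using fun i => exists_distUniform_le (f i) hρ
    (Finset.sum_nonneg fun x _ => hρ0 x) htr
  have hmain := hashing_bound hδ hf hR hY hYc S hS hS1
  simp only [hA, hRR, hσ1, htr, Complex.one_re, one_mul, mul_one] at hmain
  have hE : 0 ≤ (R * (∑ x, W * ρ x * W) * (R * ∑ x, W * ρ x * W)).trace.re := by
    have h0 : 0 ≤ ∑ x, W * ρ x * W := Finset.sum_nonneg fun x _ => hY x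
    rw [← Matrix.mul_assoc]
    exact re_trace_mul_nonneg (sandwich_nonneg hRh h0) h0
  calc avgDistUniform f ρ ≤ ∑ i, 1 / (Fintype.card ι : ℝ) *
        (1 / 2 * (S i * (cqOp (hashOp (f i) ρ) - maxMixed Z ⊗ₖ ∑ x, ρ x)).trace.re) :=
        Finset.sum_le_sum fun i _ => mul_le_mul_of_nonneg_left (hSd i) (by positivity)
    _ = 1 / 2 * ∑ i, 1 / (Fintype.card ι : ℝ) *
        (S i * (cqOp (hashOp (f i) ρ) - maxMixed Z ⊗ₖ ∑ x, ρ x)).trace.re := by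
        rw [Finset.mul_sum]
        exact Finset.sum_congr rfl fun i _ => by ring
    _ ≤ _ := by
        refine mul_le_mul_of_nonneg_left (hmain.trans (Real.sqrt_le_sqrt ?_)) (by norm_num)
        have := mul_nonneg (sub_nonneg.2 hδZ) hE
        linarith

/-- The bound for families with `|Z| δ ≥ 1`, where the marginal term must be bounded too. With
`τ = ∑ ρ x` and `ω = τ + η σ`, the state is damped by `G = √τ ω^(-1/2)`: this makes both
`ω^(-1/2) ρ x ω^(-1/2) ≤ c / η` and `ω^(-1/2) τ ω^(-1/2) ≤ 1`, and moves the state by at most `ε`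
for `η = ε² / (2 + ε²)`, whose inverse is `2 / ε² + 1`. -/
theorem avgDistUniform_le_of_almostTwoUniversal {δ : ℝ} (hδ : 0 ≤ δ) {f : ι → X → Z}
    (hf : AlmostTwoUniversal f δ) (hδZ : 1 ≤ Fintype.card Z * δ) {ρ : X → Matrix e e ℂ}
    (hρ : IsCQ ρ) {σ : Matrix e e ℂ} (hσ : σ.PosDef) (hσ1 : σ.trace = 1) {c : ℝ} (hc0 : 0 ≤ c)
    (hc : ∀ x, ρ x ≤ c • σ) {ε : ℝ} (hε : 0 < ε) :
    avgDistUniform f ρ ≤ 1 / 2 * Real.sqrt ((Fintype.card Z * δ - 1) +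
      Fintype.card Z * (c * (2 / ε ^ 2 + 1))) + ε := by
  have hρ0 : ∀ x, 0 ≤ ρ x := fun x => Matrix.nonneg_iff_posSemidef.2 (hρ.1 x)
  obtain ⟨τ, hτ⟩ : ∃ τ, τ = ∑ x, ρ x := ⟨_, rfl⟩
  have hτ0 : 0 ≤ τ := hτ ▸ Finset.sum_nonneg fun x _ => hρ0 x
  have hτ1 : τ.trace = 1 := by rw [hτ, Matrix.trace_sum, hρ.2]
  obtain ⟨η, hη⟩ : ∃ η, η = ε ^ 2 / (2 + ε ^ 2) := ⟨_, rfl⟩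
  have hη0 : 0 < η := by rw [hη]; positivity
  have hηinv : η⁻¹ = 2 / ε ^ 2 + 1 := by rw [hη]; field_simp
  have hησ : 0 ≤ η • σ := Matrix.nonneg_iff_posSemidef.2 (hσ.posSemidef.smul hη0.le)
  have hω : (τ + η • σ).PosDef :=
    Matrix.PosDef.posSemidef_add (Matrix.nonneg_iff_posSemidef.1 hτ0) (hσ.smul hη0)
  have hτω : τ ≤ τ + η • σ := le_add_of_nonneg_right hησ
  have hσω : η • σ ≤ τ + η • σ := le_add_of_nonneg_left hτ0
  obtain ⟨R, W, hR, hRR, hW, hWR, hRW⟩ := exists_sqrt_inv hω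
  have hWω : W * (τ + η • σ) * W = 1 := by
    rw [← hRR, ← Matrix.mul_assoc, hWR, Matrix.one_mul, hRW]
  obtain ⟨B, hB, hBB⟩ : ∃ B : Matrix e e ℂ, 0 ≤ B ∧ B * B = τ :=
    ⟨CFC.sqrt τ, CFC.sqrt_nonneg τ, CFC.sqrt_mul_sqrt_self τ hτ0⟩
  have hBh : B.IsHermitian := (Matrix.nonneg_iff_posSemidef.1 hB).1
  have hY : ∀ x, 0 ≤ W * ρ x * W := fun x => sandwich_nonneg hW (hρ0 x)
  have hYc : ∀ x, W * ρ x * W ≤ (c * η⁻¹) • (1 : Matrix e e ℂ) := fun x => by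
    have h1 : ρ x ≤ (c * η⁻¹) • (τ + η • σ) := by
      refine (hc x).trans ?_
      have h2 : c • σ = (c * η⁻¹) • (η • σ) := by
        rw [smul_smul, inv_mul_cancel_right₀ hη0.ne']
      rw [h2, ← sub_nonneg, ← smul_sub]
      exact Matrix.nonneg_iff_posSemidef.2 ((Matrix.le_iff.1 hσω).smul (by positivity))
    have h := conj_mono h1 W
    rwa [hW.eq, Matrix.mul_smul, Matrix.smul_mul, hWω] at h
  have hYsum : ∑ x, W * ρ x * W = W * τ * W := by rw [hτ, Finset.mul_sum, Finset.sum_mul]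
  have hYE0 : 0 ≤ W * τ * W := sandwich_nonneg hW hτ0
  have hYE : W * τ * W ≤ 1 := by
    have h := conj_mono hτω W
    rwa [hW.eq, hWω] at h
  -- the damped state `G ρ G*`, its marginal and its weight `w`
  obtain ⟨G, hG⟩ : ∃ G, G = B * W := ⟨_, rfl⟩
  have hGh : G.conjTranspose = W * B := by rw [hG, Matrix.conjTranspose_mul, hW.eq, hBh.eq]
  have hGG : G.conjTranspose * G ≤ 1 := by
    have : G.conjTranspose * G = W * τ * W := by
      rw [hGh, hG, ← hBB]; simp only [Matrix.mul_assoc]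
    rwa [this]
  have hsand : ∀ P : Matrix e e ℂ, B * (W * P * W) * B = G * P * G.conjTranspose := fun P => by
    rw [hGh, hG]; simp only [Matrix.mul_assoc]
  have hτ'0 : 0 ≤ G * τ * G.conjTranspose := by
    rw [← hsand]; exact sandwich_nonneg hBh hYE0
  obtain ⟨w, hw⟩ : ∃ w, w = (G * τ * G.conjTranspose).trace.re := ⟨_, rfl⟩
  have hw' : (G * τ * G.conjTranspose).trace = (w : ℂ) := by
    have := (Complex.le_def.1 (Matrix.nonneg_iff_posSemidef.1 hτ'0).trace_nonneg).2
    exact Complex.ext (by simp [hw]) (by simpa using this.symm)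
  have hw0 : 0 ≤ w := hw ▸ re_trace_nonneg hτ'0
  have hw1 : w ≤ 1 := by
    have h := re_trace_mul_mono hτ0 hYE
    rw [Matrix.mul_one, hτ1, Complex.one_re, ← hBB, Matrix.mul_assoc, Matrix.trace_mul_comm,
      hBB, hsand, ← hw] at h
    exact h
  -- the overlap `tr G τ` is close to one since the square root is operator monotone
  have hF : 1 - η ≤ (G * τ).trace.re := by
    have h1 : (G * (τ + η • σ)).trace.re = (B * R).trace.re := by
      rw [hG, ← hRR, Matrix.mul_assoc, ← Matrix.mul_assoc W, hWR, Matrix.one_mul]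
    have h2 : B ≤ R := le_of_mul_self_le hB hR (by rwa [hBB, hRR])
    have h3 := re_trace_mul_mono hB h2
    have h4 := re_trace_contraction_mul_le hGG hησ
    rw [hBB, hτ1, Complex.one_re] at h3
    rw [Matrix.trace_smul, hσ1, Complex.smul_re, Complex.one_re, smul_eq_mul, mul_one] at h4
    rw [Matrix.mul_add, Matrix.trace_add, Complex.add_re] at h1
    linarith
  have hFw : 0 ≤ 1 + w - 2 * (G * τ).trace.re := by
    have h := re_trace_conjTranspose_mul_self_nonneg (B - G * B)
    rwa [re_trace_sub_conjTranspose_mul_self, hBh.eq, hBB, hτ1, ← hw, Complex.one_re] at h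
  -- the reference state: the marginal of the damped state, topped up to weight one
  obtain ⟨σ', hσ'⟩ : ∃ σ', σ' = G * τ * G.conjTranspose + (1 - w) • τ := ⟨_, rfl⟩
  have hwτ : 0 ≤ (1 - w) • τ := Matrix.nonneg_iff_posSemidef.2
    ((Matrix.nonneg_iff_posSemidef.1 hτ0).smul (sub_nonneg.2 hw1))
  have hσ'1 : σ'.trace = 1 := by
    rw [hσ', Matrix.trace_add, hw', Matrix.trace_smul, hτ1]
    simp
  choose S hS hS1 hSd using fun i => exists_distUniform_le (f i) hρ
    (hσ'.symm ▸ add_nonneg hτ'0 hwτ) hσ'1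
  have hmain := hashing_bound hδ hf hB hY hYc S hS hS1
  have hAsum : ∑ x, B * (W * ρ x * W) * B = G * τ * G.conjTranspose := by
    rw [← hsand, ← hYsum, Finset.mul_sum, Finset.sum_mul]
  rw [hAsum, hYsum, hBB, hτ1, ← hw, Complex.one_re, one_mul] at hmain
  have hE : (B * (W * τ * W) * (B * (W * τ * W))).trace.re ≤ 1 := by
    have h := re_trace_mul_mono (sandwich_nonneg hBh hYE0) hYE
    rw [Matrix.mul_one, hsand, ← hw, ← hsand] at h
    rw [← Matrix.mul_assoc]
    exact h.trans hw1
  have hterm : ∀ i, (S i * (cqOp (hashOp (f i) ρ) - maxMixed Z ⊗ₖ σ')).trace.re ≤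
      (S i * (cqOp (hashOp (f i) fun x => B * (W * ρ x * W) * B) -
        maxMixed Z ⊗ₖ (G * τ * G.conjTranspose))).trace.re + 2 * ε := by
    intro i
    have hSc : (S i).conjTranspose * S i ≤ 1 := by rw [(hS i).eq, hS1]
    have hSc' : (-S i).conjTranspose * (-S i) ≤ 1 := by
      rw [Matrix.conjTranspose_neg, neg_mul_neg]; exact hSc
    have hP : 0 ≤ cqOp (hashOp (f i) ρ) := cqOp_nonneg (hashOp_nonneg (f i) hρ0)
    have hconj :
        (cqOp fun _ : Z => G) * cqOp (hashOp (f i) ρ) * (cqOp fun _ : Z => G).conjTranspose =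
        cqOp (hashOp (f i) fun x => B * (W * ρ x * W) * B) := by
      simp only [hsand, cqOp_conjTranspose, cqOp_mul]
      congr 1
      funext z
      rw [hashOp_conj]
    have d1 := re_trace_mul_sub_conj_le hSc hP (cqOp fun _ : Z => G)
    have t1 : (cqOp (hashOp (f i) ρ)).trace.re = 1 := by
      rw [trace_cqOp, ← Matrix.trace_sum, sum_hashOp, ← hτ, hτ1, Complex.one_re]
    have t2 : (cqOp (hashOp (f i) fun x => B * (W * ρ x * W) * B)).trace.re = w := by
      rw [trace_cqOp, ← Matrix.trace_sum, sum_hashOp, hAsum, hw]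
    have t3 : ((cqOp fun _ : Z => G) * cqOp (hashOp (f i) ρ)).trace.re = (G * τ).trace.re := by
      rw [cqOp_mul, trace_cqOp, ← Matrix.trace_sum, ← Finset.mul_sum, sum_hashOp, ← hτ]
    rw [hconj, t1, t2, t3] at d1
    have d2 := half_sqrt_mul_sqrt_add_le hε (by rwa [← hη]) hw0 hw1 hFw
    have d3 := re_trace_contraction_mul_le hSc' (maxMixed_kronecker_nonneg (Z := Z) hwτ)
    rw [trace_maxMixed_kronecker, Matrix.trace_smul, hτ1, Complex.smul_re, Complex.one_re,
      smul_eq_mul, mul_one, Matrix.neg_mul, Matrix.trace_neg, Complex.neg_re] at d3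
    have hsplit : S i * (cqOp (hashOp (f i) ρ) - maxMixed Z ⊗ₖ σ') =
        S i * (cqOp (hashOp (f i) ρ) - cqOp (hashOp (f i) fun x => B * (W * ρ x * W) * B)) +
        S i * (cqOp (hashOp (f i) fun x => B * (W * ρ x * W) * B) -
          maxMixed Z ⊗ₖ (G * τ * G.conjTranspose)) - S i * (maxMixed Z ⊗ₖ ((1 - w) • τ)) := by
      rw [hσ', Matrix.kronecker_add, ← Matrix.mul_add, ← Matrix.mul_sub]
      congr 1
      abel
    rw [hsplit, Matrix.trace_sub, Matrix.trace_add, Complex.sub_re, Complex.add_re]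
    linarith
  have hcι : (Fintype.card ι : ℝ) ≠ 0 := by exact_mod_cast Fintype.card_ne_zero
  calc avgDistUniform f ρ ≤ ∑ i, 1 / (Fintype.card ι : ℝ) *
        (1 / 2 * ((S i * (cqOp (hashOp (f i) fun x => B * (W * ρ x * W) * B) -
        maxMixed Z ⊗ₖ (G * τ * G.conjTranspose))).trace.re + 2 * ε)) :=
        Finset.sum_le_sum fun i _ => mul_le_mul_of_nonneg_left ((hSd i).trans
          (mul_le_mul_of_nonneg_left (hterm i) (by norm_num))) (by positivity)
    _ = 1 / 2 * ∑ i, 1 / (Fintype.card ι : ℝ) *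
        (S i * (cqOp (hashOp (f i) fun x => B * (W * ρ x * W) * B) -
        maxMixed Z ⊗ₖ (G * τ * G.conjTranspose))).trace.re + ε := by
        simp only [mul_add, Finset.sum_add_distrib, Finset.sum_const, Finset.card_univ,
          nsmul_eq_mul, Finset.mul_sum]
        congr 1
        · exact Finset.sum_congr rfl fun i _ => by ring
        · field_simp
    _ ≤ _ := by
        refine add_le_add_left (mul_le_mul_of_nonneg_left (hmain.trans (Real.sqrt_le_sqrt ?_))
          (by norm_num)) _
        rw [← hηinv, add_comm]
        refine add_le_add ?_ ?_
        · exact (mul_le_mul_of_nonneg_left hE (sub_nonneg.2 hδZ)).trans_eq (mul_one _)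
        · refine mul_le_mul_of_nonneg_left ?_ (Nat.cast_nonneg _)
          exact (mul_le_mul_of_nonneg_left hw1 (by positivity)).trans_eq (mul_one _)

end Bounds

/-! ### States witnessing the min-entropy -/

section MinEntropy

variable {X e : Type*} [Fintype X] [Fintype e]

lemma IsCQ.nonempty {ρ : X → Matrix e e ℂ} (hρ : IsCQ ρ) : Nonempty e := by
  by_contra h
  rw [not_nonempty_iff] at h
  have := hρ.2
  simp [Matrix.trace] at this

variable [DecidableEq X] [DecidableEq e]

lemma maxMixed_posDef [Nonempty e] : (maxMixed e).PosDef :=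
  Matrix.PosDef.one.smul (by have : 0 < Fintype.card e := Fintype.card_pos; positivity)

lemma trace_maxMixed [Nonempty e] : (maxMixed e).trace = 1 := by
  have hc : (Fintype.card e : ℂ) ≠ 0 := by exact_mod_cast Fintype.card_ne_zero
  simp [maxMixed, hc]

/-- Every rate below the min-entropy is witnessed by a state, which can be taken to be positive
definite by mixing in a little of the maximally mixed state. -/
lemma exists_posDef_of_lt_minEntropy {ρ : X → Matrix e e ℂ} (hρ : IsCQ ρ) {t : ℝ}
    (ht : t < minEntropy (cqOp ρ)) :
    ∃ σ : Matrix e e ℂ, σ.PosDef ∧ σ.trace = 1 ∧ ∀ x, ρ x ≤ (2 : ℝ) ^ (-t) • σ := by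
  have hne := hρ.nonempty
  have hd : (0 : ℝ) < Fintype.card e := by exact_mod_cast Fintype.card_pos
  rw [minEntropy] at ht
  obtain ⟨t', ⟨σ, ⟨hσ, hσ1⟩, hle⟩, htt'⟩ := exists_lt_of_lt_csSup (by
    refine ⟨-Real.logb 2 (Fintype.card e), maxMixed e,
      ⟨maxMixed_posDef.posSemidef, trace_maxMixed⟩, ?_⟩
    have h := le_re_trace_smul_one (cqOp_nonneg fun x => Matrix.nonneg_iff_posSemidef.2 (hρ.1 x))
    rw [trace_cqOp, hρ.2, Complex.one_re, one_smul] at h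
    rw [neg_neg, Real.rpow_logb (by norm_num) (by norm_num) hd, maxMixed, Matrix.kronecker_smul,
      Matrix.one_kronecker_one, smul_smul, mul_one_div_cancel hd.ne', one_smul]
    exact h) ht
  rw [one_kronecker_eq_cqOp, smul_cqOp] at hle
  have hκ : (2 : ℝ) ^ (t - t') < 1 := Real.rpow_lt_one_of_one_lt_of_neg (by norm_num) (by linarith)
  have hκ0 : (0 : ℝ) < 2 ^ (t - t') := by positivity
  obtain ⟨κ, hκe⟩ : ∃ κ : ℝ, κ = 2 ^ (t - t') := ⟨_, rfl⟩
  rw [← hκe] at hκ hκ0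
  have hmix : ((1 - κ) • maxMixed e).PosDef := maxMixed_posDef.smul (sub_pos.2 hκ)
  refine ⟨κ • σ + (1 - κ) • maxMixed e,
    Matrix.PosDef.posSemidef_add (hσ.smul hκ0.le) hmix, ?_, fun x => ?_⟩
  · rw [Matrix.trace_add, Matrix.trace_smul, Matrix.trace_smul, hσ1, trace_maxMixed]
    simp
  · refine (le_of_cqOp_le_cqOp hle x).trans ?_
    have h1 : (2 : ℝ) ^ (-t') = 2 ^ (-t) * κ := by
      rw [hκe, ← Real.rpow_add (by norm_num)]
      congr 1
      ring
    rw [smul_add, smul_smul, ← h1]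
    exact le_add_of_nonneg_right
      (Matrix.nonneg_iff_posSemidef.2 (hmix.posSemidef.smul (by positivity)))

end MinEntropy

lemma le_of_forall_lt_of_continuous {g : ℝ → ℝ} (hg : Continuous g) {a H : ℝ}
    (h : ∀ t < H, a ≤ g t) : a ≤ g H :=
  ge_of_tendsto (hg.continuousWithinAt (s := Set.Iio H) (x := H))
    (Filter.eventually_of_mem self_mem_nhdsWithin h)

end QHash

theorem lemma2 {ι X e : Type*} [Fintype ι] [Nonempty ι] [Fintype X] [DecidableEq X]
    [Fintype e] [DecidableEq e] (ℓ : ℕ) (δ : ℝ) (hδ : 0 ≤ δ)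
    (ρ : X → Matrix e e ℂ) (hρ : QHash.IsCQ ρ)
    (f : ι → X → (Fin ℓ → Bool)) (hf : QHash.AlmostTwoUniversal f δ) :
    QHash.avgDistUniform f ρ ≤
        (⨅ ε : {ε : ℝ // 0 < ε},
          ((1 / 2 : ℝ) * Real.sqrt (((2 : ℝ) ^ ℓ * δ - 1) +
              (2 : ℝ) ^ ((ℓ : ℝ) - QHash.minEntropy (QHash.cqOp ρ) +
                Real.logb 2 (2 / (ε : ℝ) ^ 2 + 1))) + (ε : ℝ))) ∧
      (δ ≤ (2 : ℝ) ^ (-(ℓ : ℝ)) →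
        QHash.avgDistUniform f ρ ≤
          (1 / 2 : ℝ) * Real.sqrt ((2 : ℝ) ^ ((ℓ : ℝ) - QHash.minEntropy (QHash.cqOp ρ)))) := by
  have hN : (Fintype.card (Fin ℓ → Bool) : ℝ) = (2 : ℝ) ^ ℓ := by simp
  have hcont : Continuous fun t : ℝ => (2 : ℝ) ^ (-t) :=
    Continuous.rpow continuous_const continuous_neg fun _ => Or.inl (by norm_num)
  obtain ⟨H, hH⟩ : ∃ H, H = QHash.minEntropy (QHash.cqOp ρ) := ⟨_, rfl⟩
  rw [← hH]
  have hsplit : (2 : ℝ) ^ ((ℓ : ℝ) - H) = 2 ^ ℓ * (2 : ℝ) ^ (-H) := by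
    rw [sub_eq_add_neg, Real.rpow_add (by norm_num), Real.rpow_natCast]
  have hsmall : (2 : ℝ) ^ ℓ * δ ≤ 1 →
      QHash.avgDistUniform f ρ ≤ 1 / 2 * Real.sqrt (2 ^ ℓ * (2 : ℝ) ^ (-H)) := by
    intro h
    refine QHash.le_of_forall_lt_of_continuous
      (g := fun t : ℝ => 1 / 2 * Real.sqrt (2 ^ ℓ * (2 : ℝ) ^ (-t))) (by fun_prop) fun t ht => ?_
    obtain ⟨σ, hσ, hσ1, hle⟩ := QHash.exists_posDef_of_lt_minEntropy hρ (hH ▸ ht)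
    have := QHash.avgDistUniform_le_of_twoUniversal hδ hf (hN.symm ▸ h) hρ hσ hσ1 hle
    rwa [hN] at this
  refine ⟨?_, fun h => ?_⟩
  · have : Nonempty {ε : ℝ // 0 < ε} := ⟨⟨1, one_pos⟩⟩
    refine le_ciInf ?_
    rintro ⟨ε, hε⟩
    have hq : (0 : ℝ) < 2 / ε ^ 2 + 1 := by positivity
    simp only
    rw [Real.rpow_add (by norm_num), Real.rpow_logb (by norm_num) (by norm_num) hq, hsplit]
    rcases le_total 1 ((2 : ℝ) ^ ℓ * δ) with h | h
    · rw [mul_assoc]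
      refine QHash.le_of_forall_lt_of_continuous (g := fun t : ℝ => 1 / 2 * Real.sqrt
        ((2 : ℝ) ^ ℓ * δ - 1 + 2 ^ ℓ * ((2 : ℝ) ^ (-t) * (2 / ε ^ 2 + 1))) + ε)
        (by fun_prop) fun t ht => ?_
      obtain ⟨σ, hσ, hσ1, hle⟩ := QHash.exists_posDef_of_lt_minEntropy hρ (hH ▸ ht)
      have := QHash.avgDistUniform_le_of_almostTwoUniversal hδ hf (hN.symm ▸ h) hρ hσ hσ1
        (by positivity) hle hε
      rwa [hN] at this
    · refine (hsmall h).trans ?_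
      obtain ⟨b, hb⟩ : ∃ b : ℝ, b = 2 ^ ℓ * (2 : ℝ) ^ (-H) := ⟨_, rfl⟩
      have hb0 : 0 ≤ b := by rw [hb]; positivity
      rw [← hb]
      -- either `b` is so small that `ε` alone suffices, or `2 b / ε²` outweighs the negative term
      rcases le_total b (ε ^ 2) with hbε | hbε
      · have h1 : Real.sqrt b ≤ ε := Real.sqrt_le_iff.2 ⟨hε.le, hbε⟩
        have := Real.sqrt_nonneg ((2 : ℝ) ^ ℓ * δ - 1 + b * (2 / ε ^ 2 + 1))
        linarith
      · have h1 : Real.sqrt b ≤ Real.sqrt ((2 : ℝ) ^ ℓ * δ - 1 + b * (2 / ε ^ 2 + 1)) := by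
          refine Real.sqrt_le_sqrt ?_
          have h2 : 1 ≤ b / ε ^ 2 := (one_le_div (by positivity)).2 hbε
          have h3 : b * (2 / ε ^ 2 + 1) = 2 * (b / ε ^ 2) + b := by ring
          have h4 : 0 ≤ (2 : ℝ) ^ ℓ * δ := by positivity
          linarith
        linarith
  · rw [hsplit]
    refine hsmall ?_
    calc (2 : ℝ) ^ ℓ * δ ≤ 2 ^ ℓ * (2 : ℝ) ^ (-(ℓ : ℝ)) := by gcongr
      _ = 1 := by
        rw [Real.rpow_neg (by norm_num), Real.rpow_natCast]
        exact mul_inv_cancel₀ (by positivity)
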